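/- Let $Q_n$ be the $n$-dimensional hypercube: its vertices are the $n$-bit binary strings, two of them being adjacent if and only if they differ in exactly one bit. In particular $Q_1\cong K_2$. For a connected graph $G$ and a graph $W$, a $W$-structure of $G$ is a subgraph of $G$ isomorphic to $W$, and a $W$-substructure of $G$ is a subgraph of $G$ isomorphic to a connected nonempty subgraph of $W$. (For $W=Q_1$ these are the edges, respectively the single vertices and the edges, of $G$.) Removing a set of subgraphs means deleting all their vertices. Let $\kappa(G;W)$ (respectively $\kappa^s(G;W)$) be the least cardinality of a set of pairwise vertex-disjoint $W$-structures (respectively $W$-substructures) of $G$ whose removal disconnects $G$, and let $D_f(G;W)$ (respectively $D_f^s(G;W)$) be the maximum diameter of a graph obtained from $G$ by removing at most $\kappa(G;W)-1$ pairwise vertex-disjoint $W$-structures (respectively at most $\kappa^s(G;W)-1$ pairwise vertex-disjoint $W$-substructures). **Theorem 3.7.** For $n\ge 3$ one has $\kappa(Q_n;Q_1)=\kappa^s(Q_n;Q_1)=n-1$, so that at most $n-2$ structures or substructures are removed in the definition of the fault diameters, and $$D_f^s(Q_3;Q_1)=D_f(Q_3;Q_1)=3,\qquad D_f^s(Q_n;Q_1)=D_f(Q_n;Q_1)=n+1\quad\text{for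 all } n\ge 4 .$$ -/

import Mathlib

/-- The `n`-dimensional hypercube `Q_n`: vertices are the `n`-bit strings, and two strings are
adjacent when they differ in exactly one position. -/
def hypercube (n : ℕ) : SimpleGraph (Fin n → Bool) where
  Adj x y := hammingDist x y = 1
  symm := ⟨fun x y h => by rw [hammingDist_comm]; exact h⟩
  loopless := ⟨fun x h => by simp at h⟩

namespace SimpleGraph

variable {V : Type*} {U : Type*}

/-- A `W`-structure of `G`: a subgraph of `G` isomorphic to `W`. -/
def IsStructure (W : SimpleGraph U) {G : SimpleGraph V} (H : G.Subgraph) : Prop :=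
  Nonempty (H.coe ≃g W)

/-- A `W`-substructure of `G`: a subgraph of `G` isomorphic to a connected (in particular
nonempty) subgraph of `W`. -/
def IsSubstructure (W : SimpleGraph U) {G : SimpleGraph V} (H : G.Subgraph) : Prop :=
  ∃ W' : W.Subgraph, W'.Connected ∧ Nonempty (H.coe ≃g W'.coe)

/-- A finite set of pairwise vertex-disjoint subgraphs of `G`, each of them satisfying `P`. -/
def IsFaultFamily {G : SimpleGraph V} (P : G.Subgraph → Prop) (F : Finset G.Subgraph) : Prop :=
  (∀ H ∈ F, P H) ∧ (F : Set G.Subgraph).Pairwise fun H K => Disjoint H.verts K.verts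

/-- The vertices of `G` that lie in no member of `F`. -/
def survivors {G : SimpleGraph V} (F : Finset G.Subgraph) : Set V :=
  {v | ∀ H ∈ F, v ∉ H.verts}

/-- The graph `G - F`, obtained from `G` by deleting all vertices of all members of `F`. -/
def removeFamily (G : SimpleGraph V) (F : Finset G.Subgraph) : SimpleGraph (survivors F) :=
  G.induce (survivors F)

/-- The least cardinality of a set of vertex-disjoint subgraphs satisfying `P` whose removal
disconnects `G`, that is, leaves two vertices not joined by a path (`⊤` if there is none). -/
noncomputable def faultConnectivity (G : SimpleGraph V) (P : G.Subgraph → Prop) : ℕ∞ :=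
  sInf {k | ∃ F : Finset G.Subgraph,
    IsFaultFamily P F ∧ ¬ (G.removeFamily F).Preconnected ∧ k = (F.card : ℕ∞)}

/-- The largest diameter of a graph obtained from `G` by removing at most
`faultConnectivity G P - 1` vertex-disjoint subgraphs satisfying `P`. The diameter is the extended
one, which is `⊤` for a disconnected graph; in particular a finite supremum is attained. -/
noncomputable def faultDiameter (G : SimpleGraph V) (P : G.Subgraph → Prop) : ℕ∞ :=
  sSup {d | ∃ F : Finset G.Subgraph, IsFaultFamily P F ∧
    (F.card : ℕ∞) ≤ faultConnectivity G P - 1 ∧ d = (G.removeFamily F).ediam}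

/-- The `W`-structure connectivity `κ(G; W)`. -/
noncomputable def structureConnectivity (G : SimpleGraph V) (W : SimpleGraph U) : ℕ∞ :=
  faultConnectivity G (IsStructure W)

/-- The `W`-substructure connectivity `κˢ(G; W)`. -/
noncomputable def substructureConnectivity (G : SimpleGraph V) (W : SimpleGraph U) : ℕ∞ :=
  faultConnectivity G (IsSubstructure W)

/-- The `W`-structure fault diameter `D_f(G; W)`. -/
noncomputable def structureFaultDiameter (G : SimpleGraph V) (W : SimpleGraph U) : ℕ∞ :=
  faultDiameter G (IsStructure W)

/-- The `W`-substructure fault diameter `D_fˢ(G; W)`. -/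
noncomputable def substructureFaultDiameter (G : SimpleGraph V) (W : SimpleGraph U) : ℕ∞ :=
  faultDiameter G (IsSubstructure W)

end SimpleGraph

/-
A fault is a vertex or an edge of `Q_n`, hence a clique, and all that matters about cliques of `Q_n`
is that `Q_n` has no triangles.

Upper bound. Let `u`, `v` be surviving vertices at distance `d`, spanning a `d`-dimensional subcube
`S`. If at most `d - 2` faults meet `S`, walk from `u` towards `v`: some step leads to a surviving
vertex whose smaller subcube misses one more fault, so an induction yields a path of length `d`. If
each fault meets `S` in at most one vertex, the same argument works with `d - 1` faults; for `n = 3`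
this settles `d = 2`, and the diameter is at most `3`. When more than `d - 2` of the at most `n - 2`
faults meet `S`, counting yields one of the `n - d` translates of `S` by a direction constant on `S`
that meets at most `d - 1` faults, all of which also meet `S`. Then each fault meets the translate
in at most one vertex, and the route through the translate has length `d + 2`. This gives diameter
at most `n + 1`, since `d = n` falls under the first case.

Lower bound. Let all faults be edges in a direction `o` at strings with a single nonzero bit
`i ≠ o`. Every path leaving the edge `{0, e_o}` goes through a direction `l` not used as some `i`.
If all `n - 1` are used, the graph is disconnected; if only `l` is missing, every path from `0` to
the complement of `e_l` has length at least `1 + n`.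
-/

open SimpleGraph
open scoped Finset

section BitStrings

variable {ι : Type*} {u v w x y : ι → Bool} {i j : ι}

/-- The subcube spanned by `u` and `v`: the bit strings agreeing with `u` wherever `u` and `v`
agree. Stating this as a disjunction makes the symmetry in `u` and `v` visible. -/
def subcube (u v : ι → Bool) : Set (ι → Bool) :=
  {w | ∀ i, w i = u i ∨ w i = v i}

lemma left_mem_subcube : u ∈ subcube u v := fun _ => Or.inl rfl

lemma subcube_comm (u v : ι → Bool) : subcube u v = subcube v u := by
  ext w
  exact forall_congr' fun _ => or_comm

lemma eq_of_mem_subcube (hw : w ∈ subcube u v) (h : u i = v i) : w i = u i := by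
  simpa [← h] using hw i

lemma ne_of_mem_subcube (hw : w ∈ subcube u v) (h : w i ≠ v i) : u i ≠ v i :=
  fun huv => h ((eq_of_mem_subcube hw huv).trans huv)

lemma hammingDist_add_of_mem_subcube [Fintype ι] (hw : w ∈ subcube u v) :
    hammingDist u w + hammingDist w v = hammingDist u v := by
  classical
  simp only [hammingDist]
  rw [← Finset.card_union_of_disjoint]
  · congr 1
    ext i
    have := hw i
    grind
  · refine Finset.disjoint_filter.2 fun i _ _ _ => ?_
    have := hw i
    grind

variable [DecidableEq ι]

/-- The bit string `x` with its `i`-th bit flipped, that is, the neighbour of `x` in direction `i`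
of the hypercube. -/
def flipBit (x : ι → Bool) (i : ι) : ι → Bool :=
  Function.update x i (!x i)

@[simp] lemma flipBit_self : flipBit x i i = !x i := by simp [flipBit]

lemma flipBit_of_ne (h : j ≠ i) : flipBit x i j = x j := by simp [flipBit, h]

@[simp] lemma flipBit_flipBit : flipBit (flipBit x i) i = x := by simp [flipBit]

lemma eq_flipBit_iff : y = flipBit x i ↔ y i ≠ x i ∧ ∀ j ≠ i, y j = x j := by
  rw [flipBit, Function.eq_update_iff, Bool.eq_not]

lemma flipBit_ne : flipBit x i ≠ x := fun h => by simpa using congrFun h i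

lemma flipBit_injective : Function.Injective (flipBit x) := by
  intro i j h
  by_contra hij
  have := congrFun h i
  simp [flipBit_of_ne hij] at this

lemma hammingDist_flipBit_add_one [Fintype ι] (h : x i ≠ y i) :
    hammingDist (flipBit x i) y + 1 = hammingDist x y := by
  rw [hammingDist, hammingDist,
    ← Finset.card_erase_add_one (s := {j | x j ≠ y j}) (a := i) (by simpa using h)]
  congr 2
  ext j
  by_cases hj : j = i
  · subst hj
    simpa [Bool.not_eq] using h
  · simp [hj, flipBit_of_ne]

lemma hammingDist_flipBit_flipBit [Fintype ι] :
    hammingDist (flipBit x i) (flipBit y i) = hammingDist x y := by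
  simp only [hammingDist]
  congr 1
  ext j
  by_cases hj : j = i
  · subst hj
    simp
  · simp [flipBit_of_ne hj]

lemma flipBit_mem_subcube (h : u i ≠ v i) : flipBit u i ∈ subcube u v := by
  intro j
  by_cases hj : j = i
  · subst hj
    exact Or.inr (by simpa [Bool.eq_not] using h)
  · exact Or.inl (flipBit_of_ne hj)

lemma mem_subcube_flipBit_left (h : u i ≠ v i) :
    w ∈ subcube (flipBit u i) v ↔ w ∈ subcube u v ∧ w i = v i := by
  have hi : (!u i) = v i := by simpa [Bool.eq_not] using h
  constructor
  · intro hw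
    have hwi : w i = v i := by simpa [hi] using hw i
    refine ⟨fun j => ?_, hwi⟩
    by_cases hj : j = i
    · exact Or.inr (hj ▸ hwi)
    · simpa [flipBit_of_ne hj] using hw j
  · rintro ⟨hw, hwi⟩ j
    by_cases hj : j = i
    · exact Or.inr (hj ▸ hwi)
    · simpa [flipBit_of_ne hj] using hw j

lemma mem_subcube_flipBit_flipBit :
    w ∈ subcube (flipBit u i) (flipBit v i) ↔ flipBit w i ∈ subcube u v := by
  refine forall_congr' fun j => ?_
  by_cases hj : j = i
  · subst hj
    simp [Bool.eq_not]
  · simp [flipBit_of_ne hj]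

lemma ne_of_mem_subcube_flipBit (h : u i = v i) (hx : x ∈ subcube u v)
    (hy : y ∈ subcube (flipBit u i) (flipBit v i)) : y i ≠ x i := by
  rw [eq_of_mem_subcube hx h, eq_of_mem_subcube hy (by simp [h])]
  simp

end BitStrings

namespace hypercube

variable {n : ℕ} {s : Set (Fin n → Bool)} {u v w x y z : Fin n → Bool} {i j k : Fin n}

lemma hammingDist_le (x y : Fin n → Bool) : hammingDist x y ≤ n := by
  simpa using hammingDist_le_card_fintype (x := x) (y := y)

lemma adj_iff_exists_eq_flipBit : (hypercube n).Adj x y ↔ ∃ i, y = flipBit x i := by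
  change hammingDist x y = 1 ↔ _
  simp_rw [hammingDist, Finset.card_eq_one, eq_flipBit_iff, Finset.ext_iff]
  refine exists_congr fun i => ?_
  simp only [Finset.mem_filter, Finset.mem_univ, true_and, Finset.mem_singleton]
  grind

lemma adj_flipBit (x : Fin n → Bool) (i : Fin n) : (hypercube n).Adj x (flipBit x i) :=
  adj_iff_exists_eq_flipBit.2 ⟨i, rfl⟩

lemma eq_flipBit_of_adj (h : (hypercube n).Adj x y) (hi : x i ≠ y i) : y = flipBit x i := by
  obtain ⟨j, rfl⟩ := adj_iff_exists_eq_flipBit.1 h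
  obtain rfl : i = j := by_contra fun hij => hi (flipBit_of_ne hij).symm
  rfl

lemma eq_of_adj (h : (hypercube n).Adj x y) (hij : i ≠ j) (hi : x i ≠ y i) : y j = x j := by
  rw [eq_flipBit_of_adj h hi, flipBit_of_ne hij.symm]

lemma not_adj_of_common_neighbor (hy : (hypercube n).Adj x y) (hz : (hypercube n).Adj x z) :
    ¬ (hypercube n).Adj y z := by
  obtain ⟨i, rfl⟩ := adj_iff_exists_eq_flipBit.1 hy
  obtain ⟨j, rfl⟩ := adj_iff_exists_eq_flipBit.1 hz
  intro h
  have hij : i ≠ j := fun hij => h.ne (hij ▸ rfl)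
  have := eq_of_adj h hij (by simp [flipBit_of_ne hij])
  simp [flipBit_of_ne hij.symm] at this

lemma eq_or_eq_or_eq_of_isClique (hs : (hypercube n).IsClique s) (hx : x ∈ s) (hy : y ∈ s)
    (hz : z ∈ s) : x = y ∨ x = z ∨ y = z := by
  by_contra! h
  exact not_adj_of_common_neighbor (hs hx hy h.1) (hs hx hz h.2.1) (hs hy hz h.2.2)

lemma encard_le_two_of_isClique (hs : (hypercube n).IsClique s) : s.encard ≤ 2 := by
  rw [← s.toFinite.cast_ncard_eq]
  by_contra! h
  obtain ⟨x, y, z, hx, hy, hz, hxy, hxz, hyz⟩ :=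
    (Set.two_lt_ncard_iff s.toFinite).1 (by exact_mod_cast h)
  grind [eq_or_eq_or_eq_of_isClique hs hx hy hz]

/-- If no direction worked, `x` and `y` below would form a triangle with a third vertex. -/
lemma exists_disjoint_subcube_flipBit (hs : (hypercube n).IsClique s) (hv : v ∉ s) (huv : u ≠ v) :
    ∃ i, u i ≠ v i ∧ Disjoint s (subcube (flipBit u i) v) := by
  by_contra! h
  have hmeet : ∀ i, u i ≠ v i → ∃ x ∈ s, x ∈ subcube u v ∧ x i = v i := fun i hi => by
    obtain ⟨x, hx, hxi⟩ := Set.not_disjoint_iff.1 (h i hi)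
    exact ⟨x, hx, (mem_subcube_flipBit_left hi).1 hxi⟩
  have hdiff : ∀ x ∈ s, ∃ i, x i ≠ v i := fun x hx =>
    Function.ne_iff.1 (ne_of_mem_of_not_mem hx hv)
  obtain ⟨k, hk⟩ := Function.ne_iff.1 huv
  obtain ⟨x, hx, hxS, -⟩ := hmeet k hk
  obtain ⟨i, hxi⟩ := hdiff x hx
  obtain ⟨y, hy, hyS, hyi⟩ := hmeet i (ne_of_mem_subcube hxS hxi)
  obtain ⟨j, hyj⟩ := hdiff y hy
  obtain ⟨z, hz, -, hzj⟩ := hmeet j (ne_of_mem_subcube hyS hyj)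
  have hxy : (hypercube n).Adj x y := hs hx hy fun h => hxi (h ▸ hyi)
  have hij : i ≠ j := by
    rintro rfl
    exact hyj hyi
  have hxj : y j = x j := eq_of_adj hxy hij (hyi ▸ hxi)
  rcases eq_or_eq_or_eq_of_isClique hs hx hy hz with rfl | rfl | rfl
  · exact hxi hyi
  · exact hyj (hxj.trans hzj)
  · exact hyj hzj

/-- If no direction in `D` worked, `s` would contain `flipBit (flipBit u k) i` for all `i ∈ D`, in
addition to `flipBit u k`. -/
lemma exists_mem_disjoint_subcube_flipBit (hs : (hypercube n).IsClique s) (hk : u k ≠ v k)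
    (hks : flipBit u k ∈ s) {D : Finset (Fin n)} (hD : ∀ i ∈ D, u i ≠ v i) (hkD : k ∉ D)
    (hcard : (s ∩ subcube u v).encard ≤ #D) :
    ∃ i ∈ D, Disjoint s (subcube (flipBit u i) v) := by
  by_contra! h
  have hmem : ∀ i ∈ D, flipBit (flipBit u k) i ∈ s ∩ subcube u v := by
    intro i hi
    obtain ⟨x, hx, hxi⟩ := Set.not_disjoint_iff.1 (h i hi)
    obtain ⟨hxS, hxi⟩ := (mem_subcube_flipBit_left (hD i hi)).1 hxi
    have hne : flipBit u k i ≠ x i := by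
      rw [flipBit_of_ne (ne_of_mem_of_not_mem hi hkD), hxi]
      exact hD i hi
    rw [← eq_flipBit_of_adj (hs hks hx fun h => hne (congrFun h i)) hne]
    exact ⟨hx, hxS⟩
  have hsub : insert (flipBit u k) (flipBit (flipBit u k) '' D) ⊆ s ∩ subcube u v :=
    Set.insert_subset ⟨hks, flipBit_mem_subcube hk⟩ (Set.image_subset_iff.2 hmem)
  have hlt := (Set.encard_le_encard hsub).trans hcard
  rw [Set.encard_insert_of_notMem (by rintro ⟨i, -, hi⟩; exact flipBit_ne hi),
    flipBit_injective.encard_image, Set.encard_coe_eq_coe_finsetCard] at hlt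
  norm_cast at hlt
  omega

end hypercube

section FaultsMeeting

variable {V : Type*} {G : SimpleGraph V} {F : Finset G.Subgraph} {S T : Set V} {H : G.Subgraph}

open scoped Classical in
/-- The members of the family `F` of faults that have a vertex in `S`. -/
noncomputable def faultsMeeting (F : Finset G.Subgraph) (S : Set V) : Finset G.Subgraph :=
  {H ∈ F | ¬ Disjoint H.verts S}

lemma mem_faultsMeeting : H ∈ faultsMeeting F S ↔ H ∈ F ∧ ¬ Disjoint H.verts S := by
  simp [faultsMeeting]

lemma mem_faultsMeeting_of_mem {x : V} (hH : H ∈ F) (hx : x ∈ H.verts) (hxS : x ∈ S) :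
    H ∈ faultsMeeting F S :=
  mem_faultsMeeting.2 ⟨hH, Set.not_disjoint_iff.2 ⟨x, hx, hxS⟩⟩

lemma faultsMeeting_mono (h : S ⊆ T) : faultsMeeting F S ⊆ faultsMeeting F T := fun _ hH =>
  mem_faultsMeeting.2 ((mem_faultsMeeting.1 hH).imp_right (mt (Disjoint.mono_right h)))

lemma card_faultsMeeting_le : #(faultsMeeting F S) ≤ #F :=
  Finset.card_le_card fun _ hH => (mem_faultsMeeting.1 hH).1

lemma card_faultsMeeting_lt (h : S ⊆ T) (hH : H ∈ faultsMeeting F T) (hd : Disjoint H.verts S) :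
    #(faultsMeeting F S) < #(faultsMeeting F T) :=
  Finset.card_lt_card
    ⟨faultsMeeting_mono h, fun hT => (mem_faultsMeeting.1 (hT hH)).2 hd⟩

lemma notMem_survivors {x : V} : x ∉ survivors F ↔ ∃ H ∈ F, x ∈ H.verts := by
  simp [survivors]

end FaultsMeeting

namespace hypercube

section Geodesic

variable {n : ℕ} {F : Finset (hypercube n).Subgraph} {u v : Fin n → Bool}

open scoped Classical in
lemma hammingDist_le_card_surviving_directions_add
    (hF : ∀ H ∈ F, (hypercube n).IsClique H.verts) :
    hammingDist u v ≤ #{i | u i ≠ v i ∧ flipBit u i ∈ survivors F} +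
      #(faultsMeeting F (subcube u v)) := by
  have hblocked : #{i | u i ≠ v i ∧ flipBit u i ∉ survivors F} ≤
      #(faultsMeeting F (subcube u v)) := by
    refine Finset.card_le_card_of_forall_subsingleton (fun i H => flipBit u i ∈ H.verts) ?_ ?_
    · intro i hi
      obtain ⟨hi, hk⟩ := (Finset.mem_filter.1 hi).2
      obtain ⟨H, hH, hm⟩ := notMem_survivors.1 hk
      exact ⟨H, mem_faultsMeeting_of_mem hH hm (flipBit_mem_subcube hi), hm⟩
    · rintro H hH i ⟨-, hi⟩ j ⟨-, hj⟩
      by_contra hij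
      exact not_adj_of_common_neighbor (adj_flipBit u i) (adj_flipBit u j)
        (hF H (mem_faultsMeeting.1 hH).1 hi hj (flipBit_injective.ne hij))
  rw [hammingDist, ← Finset.card_filter_add_card_filter_not (fun i => flipBit u i ∈ survivors F),
    Finset.filter_filter, Finset.filter_filter]
  gcongr

variable {r : ℕ}

lemma exists_flipBit_mem_survivors_card_le (hF : ∀ H ∈ F, (hypercube n).IsClique H.verts)
    (hv : v ∈ survivors F) (hr : ∀ H ∈ F, (H.verts ∩ subcube u v).encard ≤ r) (huv : u ≠ v)
    (hcard : #(faultsMeeting F (subcube u v)) ≤ hammingDist u v - r) :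
    ∃ i, u i ≠ v i ∧ flipBit u i ∈ survivors F ∧
      #(faultsMeeting F (subcube (flipBit u i) v)) ≤ #(faultsMeeting F (subcube u v)) - 1 := by
  classical
  have hsub : ∀ i, u i ≠ v i → subcube (flipBit u i) v ⊆ subcube u v :=
    fun i hi w hw => ((mem_subcube_flipBit_left hi).1 hw).1
  by_cases hblocked : ∃ k, u k ≠ v k ∧ flipBit u k ∉ survivors F
  · obtain ⟨k, hk, hks⟩ := hblocked
    obtain ⟨H, hH, hkH⟩ := notMem_survivors.1 hks
    have hHm := mem_faultsMeeting_of_mem hH hkH (flipBit_mem_subcube hk)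
    have hgood : r ≤ #{i | u i ≠ v i ∧ flipBit u i ∈ survivors F} := by
      have := hammingDist_le_card_surviving_directions_add (u := u) (v := v) hF
      have := Finset.card_pos.2 ⟨H, hHm⟩
      omega
    obtain ⟨i, hi, hd⟩ := exists_mem_disjoint_subcube_flipBit (hF H hH) hk hkH
      (D := {i | u i ≠ v i ∧ flipBit u i ∈ survivors F})
      (fun i hi => (Finset.mem_filter.1 hi).2.1) (by simp [hks])
      ((hr H hH).trans (by exact_mod_cast hgood))
    obtain ⟨hi, his⟩ := (Finset.mem_filter.1 hi).2
    exact ⟨i, hi, his, Nat.le_sub_one_of_lt (card_faultsMeeting_lt (hsub i hi) hHm hd)⟩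
  · push Not at hblocked
    rcases (faultsMeeting F (subcube u v)).eq_empty_or_nonempty with he | ⟨H, hH⟩
    · obtain ⟨i, hi⟩ := Function.ne_iff.1 huv
      refine ⟨i, hi, hblocked i hi, ?_⟩
      simpa [he] using faultsMeeting_mono (F := F) (hsub i hi)
    · have hHF := (mem_faultsMeeting.1 hH).1
      obtain ⟨i, hi, hd⟩ := exists_disjoint_subcube_flipBit (hF H hHF) (hv H hHF) huv
      exact ⟨i, hi, hblocked i hi, Nat.le_sub_one_of_lt (card_faultsMeeting_lt (hsub i hi) hH hd)⟩

lemma edist_flipBit {u : survivors F} {i : Fin n} (hi : flipBit u i ∈ survivors F) :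
    ((hypercube n).removeFamily F).edist u ⟨flipBit u i, hi⟩ = 1 :=
  edist_eq_one_iff_adj.2 (adj_flipBit u.1 i)

/-- The subtraction is truncated: when no fault meets the subcube, `r` may exceed the distance. This
is what lets the induction reach `v`. -/
theorem edist_le_hammingDist_of_encard_le (hF : ∀ H ∈ F, (hypercube n).IsClique H.verts)
    (u v : survivors F) (hr : ∀ H ∈ F, (H.verts ∩ subcube u.1 v.1).encard ≤ r)
    (hcard : #(faultsMeeting F (subcube u.1 v.1)) ≤ hammingDist u.1 v.1 - r) :
    ((hypercube n).removeFamily F).edist u v ≤ hammingDist u.1 v.1 := by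
  induction hd : hammingDist u.1 v.1 generalizing u with
  | zero =>
    obtain rfl : u = v := Subtype.ext (hammingDist_eq_zero.1 hd)
    simp
  | succ d ih =>
    obtain ⟨i, hi, his, hic⟩ := exists_flipBit_mem_survivors_card_le hF v.2 hr
      (hammingDist_pos.1 (by omega)) hcard
    have hdi := hammingDist_flipBit_add_one hi
    have hr' : ∀ H ∈ F, (H.verts ∩ subcube (flipBit u.1 i) v.1).encard ≤ r := fun H hH =>
      (Set.encard_le_encard (Set.inter_subset_inter_right _ fun w hw =>
        ((mem_subcube_flipBit_left hi).1 hw).1)).trans (hr H hH)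
    calc ((hypercube n).removeFamily F).edist u v
      _ ≤ ((hypercube n).removeFamily F).edist u ⟨flipBit u.1 i, his⟩ +
          ((hypercube n).removeFamily F).edist ⟨flipBit u.1 i, his⟩ v :=
        SimpleGraph.edist_triangle
      _ ≤ 1 + d := add_le_add (edist_flipBit his).le (ih _ hr' (by dsimp; omega) (by dsimp; omega))
      _ = (d + 1 : ℕ) := by rw [add_comm, Nat.cast_succ]

theorem edist_le_hammingDist (hF : ∀ H ∈ F, (hypercube n).IsClique H.verts) (u v : survivors F)
    (hcard : #(faultsMeeting F (subcube u.1 v.1)) ≤ hammingDist u.1 v.1 - 2) :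
    ((hypercube n).removeFamily F).edist u v ≤ hammingDist u.1 v.1 :=
  edist_le_hammingDist_of_encard_le hF u v (r := 2)
    (fun H hH => (Set.encard_le_encard Set.inter_subset_left).trans
      (encard_le_two_of_isClique (hF H hH))) hcard

theorem edist_le_hammingDist_of_subsingleton (hF : ∀ H ∈ F, (hypercube n).IsClique H.verts)
    (u v : survivors F) (hs : ∀ H ∈ F, (H.verts ∩ subcube u.1 v.1).Subsingleton)
    (hcard : #(faultsMeeting F (subcube u.1 v.1)) ≤ hammingDist u.1 v.1 - 1) :
    ((hypercube n).removeFamily F).edist u v ≤ hammingDist u.1 v.1 :=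
  edist_le_hammingDist_of_encard_le hF u v (r := 1)
    (fun H hH => Set.encard_le_one_iff_subsingleton.2 (hs H hH)) hcard

end Geodesic

section Translate

variable {n : ℕ} {F : Finset (hypercube n).Subgraph} {s : Set (Fin n → Bool)}
  {u v : Fin n → Bool} {i j : Fin n}

lemma subsingleton_inter_subcube_flipBit (hs : (hypercube n).IsClique s) (hi : u i = v i)
    (hmeet : ¬ Disjoint s (subcube u v)) :
    (s ∩ subcube (flipBit u i) (flipBit v i)).Subsingleton := by
  rintro x ⟨hx, hxT⟩ y ⟨hy, hyT⟩
  obtain ⟨w, hw, hwS⟩ := Set.not_disjoint_iff.1 hmeet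
  rcases eq_or_eq_or_eq_of_isClique hs hx hy hw with hxy | rfl | rfl
  · exact hxy
  · exact absurd rfl (ne_of_mem_subcube_flipBit hi hwS hxT)
  · exact absurd rfl (ne_of_mem_subcube_flipBit hi hwS hyT)

lemma left_mem_of_flipBit_mem (hs : (hypercube n).IsClique s) (hi : u i = v i)
    (hmeet : ¬ Disjoint s (subcube u v)) (hu : flipBit u i ∈ s) : u ∈ s := by
  obtain ⟨w, hw, hwS⟩ := Set.not_disjoint_iff.1 hmeet
  have hne := ne_of_mem_subcube_flipBit hi hwS left_mem_subcube
  have hwu := eq_flipBit_of_adj (hs hu hw fun h => hne (congrFun h i)) hne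
  rwa [hwu, flipBit_flipBit] at hw

lemma eq_of_meets_translates (hs : (hypercube n).IsClique s) (hi : u i = v i) (hj : u j = v j)
    (hsi : ¬ Disjoint s (subcube (flipBit u i) (flipBit v i)))
    (hsj : ¬ Disjoint s (subcube (flipBit u j) (flipBit v j))) : i = j := by
  by_contra hij
  obtain ⟨x, hx, hxT⟩ := Set.not_disjoint_iff.1 hsi
  obtain ⟨y, hy, hyT⟩ := Set.not_disjoint_iff.1 hsj
  have hdiff : ∀ {a b : Fin n} {p q : Fin n → Bool}, a ≠ b → u a = v a →
      p ∈ subcube (flipBit u a) (flipBit v a) → q ∈ subcube (flipBit u b) (flipBit v b) →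
      p a ≠ q a := fun hab ha hp hq => by
    have := ne_of_mem_subcube_flipBit ha (mem_subcube_flipBit_flipBit.1 hq) hp
    rwa [flipBit_of_ne hab] at this
  have hxy : (hypercube n).Adj x y :=
    hs hx hy fun h => hdiff hij hi hxT hyT (congrFun h i)
  exact hdiff (Ne.symm hij) hj hyT hxT (eq_of_adj hxy hij (hdiff hij hi hxT hyT))

lemma edist_le_hammingDist_add_two_of_translate (hF : ∀ H ∈ F, (hypercube n).IsClique H.verts)
    (u v : survivors F) (hi : u.1 i = v.1 i)
    (hmeet : ∀ H ∈ faultsMeeting F (subcube (flipBit u i) (flipBit v i)),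
      ¬ Disjoint H.verts (subcube u.1 v.1))
    (hcard : #(faultsMeeting F (subcube (flipBit u i) (flipBit v i))) ≤ hammingDist u.1 v.1 - 1) :
    ((hypercube n).removeFamily F).edist u v ≤ hammingDist u.1 v.1 + 2 := by
  have hu : flipBit u i ∈ survivors F := fun H hH hm =>
    u.2 H hH (left_mem_of_flipBit_mem (hF H hH) hi
      (hmeet H (mem_faultsMeeting_of_mem hH hm left_mem_subcube)) hm)
  have hv : flipBit v i ∈ survivors F := fun H hH hm =>
    v.2 H hH (left_mem_of_flipBit_mem (v := u) (hF H hH) hi.symm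
      (subcube_comm u.1 v.1 ▸ hmeet H (mem_faultsMeeting_of_mem hH hm
        (subcube_comm (flipBit v.1 i) (flipBit u.1 i) ▸ left_mem_subcube))) hm)
  have hs : ∀ H ∈ F,
      (H.verts ∩ subcube (flipBit u.1 i) (flipBit v.1 i)).Subsingleton := by
    rintro H hH x hx
    have hHm := hmeet H (mem_faultsMeeting_of_mem hH hx.1 hx.2)
    exact subsingleton_inter_subcube_flipBit (hF H hH) hi hHm hx
  have hmid := edist_le_hammingDist_of_subsingleton hF ⟨_, hu⟩ ⟨_, hv⟩ hs
    (by rwa [hammingDist_flipBit_flipBit])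
  rw [hammingDist_flipBit_flipBit] at hmid
  calc ((hypercube n).removeFamily F).edist u v
    _ ≤ ((hypercube n).removeFamily F).edist u ⟨_, hu⟩ +
          ((hypercube n).removeFamily F).edist ⟨_, hu⟩ ⟨_, hv⟩ +
          ((hypercube n).removeFamily F).edist ⟨_, hv⟩ v :=
      SimpleGraph.edist_triangle.trans (add_le_add_left SimpleGraph.edist_triangle _)
    _ ≤ 1 + hammingDist u.1 v.1 + 1 := by
      gcongr
      · exact (edist_flipBit hu).le
      · rw [edist_comm, edist_flipBit]
    _ = hammingDist u.1 v.1 + 2 := by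
      rw [add_comm 1, add_assoc, one_add_one_eq_two]

end Translate

end hypercube

/-- In the application, `C` consists of the directions constant on a subcube of dimension `d`, `F`
of the faults, `p` says that a fault meets the subcube, and `R i` that it meets the translate in
direction `i`. -/
lemma exists_rel_imp_and_card_filter_lt {α β : Type*} {R : α → β → Prop} {p : β → Prop}
    [DecidableRel R] [DecidablePred p] {C : Finset α} {F : Finset β} {d : ℕ}
    (hR : ∀ b ∈ F, {i | i ∈ C ∧ R i b}.Subsingleton) (hd : 0 < d)
    (hp : d ≤ #{b ∈ F | p b} + 1) (hF : #F + 2 ≤ #C + d) :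
    ∃ i ∈ C, (∀ b ∈ F, R i b → p b) ∧ #{b ∈ F | R i b} < d := by
  classical
  by_contra! h
  let Z := {i ∈ C | ∀ b ∈ F, R i b → p b}
  have hsplit : #{b ∈ F | p b} + #{b ∈ F | ¬ p b} = #F := Finset.card_filter_add_card_filter_not _
  have hZ : #C ≤ #Z + #{b ∈ F | ¬ p b} := by
    have hrel : #{i ∈ C | ¬ ∀ b ∈ F, R i b → p b} ≤ #{b ∈ F | ¬ p b} := by
      refine Finset.card_le_card_of_forall_subsingleton R (fun i hi => ?_) fun b hb =>
        (hR b (Finset.mem_filter.1 hb).1).anti fun i hi => ⟨(Finset.mem_filter.1 hi.1).1, hi.2⟩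
      obtain ⟨b, hb, hib, hpb⟩ : ∃ b ∈ F, R i b ∧ ¬ p b := by simpa using (Finset.mem_filter.1 hi).2
      exact ⟨b, Finset.mem_filter.2 ⟨hb, hpb⟩, hib⟩
    have : #Z + _ = #C := Finset.card_filter_add_card_filter_not _
    omega
  have hcount : #Z * d ≤ #{b ∈ F | p b} * 1 := by
    refine Finset.card_mul_le_card_mul R (fun i hi => ?_) fun b hb => ?_
    · obtain ⟨hiC, hip⟩ := Finset.mem_filter.1 hi
      refine (h i hiC hip).trans (Finset.card_le_card fun b hb => ?_)
      obtain ⟨hbF, hib⟩ := Finset.mem_filter.1 hb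
      exact Finset.mem_filter.2 ⟨Finset.mem_filter.2 ⟨hbF, hip b hbF hib⟩, hib⟩
    · refine Finset.card_le_one_iff_subsingleton.2 <|
        (hR b (Finset.mem_filter.1 hb).1).anti fun i hi => ?_
      obtain ⟨hiZ, hib⟩ := Finset.mem_filter.1 hi
      exact ⟨(Finset.mem_filter.1 hiZ).1, hib⟩
  nlinarith

namespace hypercube

section Diameter

variable {n : ℕ} {F : Finset (hypercube n).Subgraph}

lemma card_eq_add_hammingDist (u v : Fin n → Bool) :
    #{i | u i = v i} + hammingDist u v = n := by
  simpa [hammingDist] using Finset.card_filter_add_card_filter_not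
    (s := (Finset.univ : Finset (Fin n))) (fun i => u i = v i)

lemma edist_le_one (u v : survivors F) (h : hammingDist u.1 v.1 ≤ 1) :
    ((hypercube n).removeFamily F).edist u v ≤ 1 := by
  rcases eq_or_ne u v with rfl | hne
  · simp
  · exact (edist_eq_one_iff_adj.2
      (h.antisymm (hammingDist_pos.2 (Subtype.coe_injective.ne hne)))).le

theorem edist_le_hammingDist_add_two (hF : ∀ H ∈ F, (hypercube n).IsClique H.verts)
    (hcard : #F ≤ n - 2) (u v : survivors F) :
    ((hypercube n).removeFamily F).edist u v ≤ hammingDist u.1 v.1 + 2 := by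
  classical
  rcases Nat.lt_or_ge (hammingDist u.1 v.1) 2 with hlt | hge
  · exact (edist_le_one u v (Nat.le_of_lt_succ hlt)).trans (le_add_left one_le_two)
  rcases Nat.lt_or_ge (hammingDist u.1 v.1 - 2) #(faultsMeeting F (subcube u.1 v.1)) with
    hblock | hfree
  · have hdim := card_eq_add_hammingDist u.1 v.1
    have hunique : ∀ H ∈ F, {i | i ∈ ({i | u.1 i = v.1 i} : Finset (Fin n)) ∧
        ¬ Disjoint H.verts (subcube (flipBit u.1 i) (flipBit v.1 i))}.Subsingleton :=
      fun H hH i hi j hj => eq_of_meets_translates (hF H hH) (by simpa using hi.1)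
        (by simpa using hj.1) hi.2 hj.2
    obtain ⟨i, hi, hmeet, hlt⟩ := exists_rel_imp_and_card_filter_lt
      (p := fun H => ¬ Disjoint H.verts (subcube u.1 v.1)) hunique (by omega)
      (Nat.le_add_of_sub_le (Nat.le_of_pred_lt hblock)) (by omega)
    refine edist_le_hammingDist_add_two_of_translate hF u v (by simpa using hi) (fun H hH => ?_)
      (Nat.le_sub_one_of_lt hlt)
    obtain ⟨hHF, hHi⟩ := mem_faultsMeeting.1 hH
    exact hmeet H hHF hHi
  · exact (edist_le_hammingDist hF u v hfree).trans le_self_add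

lemma edist_le_of_hammingDist_eq (hF : ∀ H ∈ F, (hypercube n).IsClique H.verts)
    (hcard : #F ≤ n - 2) (u v : survivors F) (hd : hammingDist u.1 v.1 = n) :
    ((hypercube n).removeFamily F).edist u v ≤ n := by
  have := edist_le_hammingDist hF u v (by rw [hd]; exact card_faultsMeeting_le.trans hcard)
  rwa [hd] at this

theorem ediam_removeFamily_le (hF : ∀ H ∈ F, (hypercube n).IsClique H.verts)
    (hcard : #F ≤ n - 2) : ((hypercube n).removeFamily F).ediam ≤ n + 1 := by
  refine ediam_le_of_edist_le fun u v => ?_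
  rcases (hammingDist_le u.1 v.1).eq_or_lt with heq | hlt
  · exact (edist_le_of_hammingDist_eq hF hcard u v heq).trans le_self_add
  · refine (edist_le_hammingDist_add_two hF hcard u v).trans ?_
    exact_mod_cast Nat.add_le_add_right (Nat.succ_le_of_lt hlt) 1

/-- Two vertices of the fault in the square spanned by `u` and `v` would form a triangle
with `u`. -/
lemma subsingleton_inter_subcube_of_hammingDist_eq_two {s : Set (Fin n → Bool)}
    {u v : Fin n → Bool} (hs : (hypercube n).IsClique s) (hu : u ∉ s) (hv : v ∉ s)
    (hd : hammingDist u v = 2) : (s ∩ subcube u v).Subsingleton := by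
  have hadj : ∀ x ∈ s ∩ subcube u v, (hypercube n).Adj u x := by
    rintro x ⟨hx, hxS⟩
    have hsum := hammingDist_add_of_mem_subcube hxS
    have hux := hammingDist_pos.2 (ne_of_mem_of_not_mem hx hu).symm
    have hxv := hammingDist_pos.2 (ne_of_mem_of_not_mem hx hv)
    change hammingDist u x = 1
    omega
  intro x hx y hy
  by_contra hne
  exact not_adj_of_common_neighbor (hadj x hx) (hadj y hy) (hs hx.1 hy.1 hne)

theorem ediam_removeFamily_three_le {F : Finset (hypercube 3).Subgraph}
    (hF : ∀ H ∈ F, (hypercube 3).IsClique H.verts) (hcard : #F ≤ 1) :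
    ((hypercube 3).removeFamily F).ediam ≤ 3 := by
  refine ediam_le_of_edist_le fun u v => ?_
  have hle := hammingDist_le u.1 v.1
  rcases (by omega : hammingDist u.1 v.1 ≤ 1 ∨ hammingDist u.1 v.1 = 2 ∨ hammingDist u.1 v.1 = 3)
    with h | h | h
  · exact (edist_le_one u v h).trans (by norm_num)
  · have hs : ∀ H ∈ F, (H.verts ∩ subcube u.1 v.1).Subsingleton := fun H hH =>
      subsingleton_inter_subcube_of_hammingDist_eq_two (hF H hH) (u.2 H hH) (v.2 H hH) h
    refine (edist_le_hammingDist_of_subsingleton hF u v hs ?_).trans (by exact_mod_cast hle)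
    rw [h]
    exact card_faultsMeeting_le.trans hcard
  · exact edist_le_of_hammingDist_eq hF hcard u v h

end Diameter

end hypercube

section Structures

variable {U V : Type*} {G : SimpleGraph V} {W : SimpleGraph U} {H : G.Subgraph}

lemma eq_top_of_preconnected_of_card_le_two [Finite V] (hG : G.Preconnected)
    (hV : Nat.card V ≤ 2) : G = ⊤ := by
  ext x y
  refine ⟨Adj.ne, fun hxy => ?_⟩
  have : Nontrivial V := ⟨x, y, hxy⟩
  obtain ⟨z, hxz⟩ := hG.exists_adj_of_nontrivial x
  obtain rfl : z = y := by
    by_contra hzy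
    have : ({x, y, z} : Set V).ncard = 3 := Set.ncard_eq_three.2
      ⟨x, y, z, hxy, hxz.ne, Ne.symm hzy, rfl⟩
    have := Set.ncard_le_card ({x, y, z} : Set V)
    omega
  exact hxz

lemma isClique_of_isSubstructure [Finite U] (hU : Nat.card U ≤ 2) (h : IsSubstructure W H) :
    G.IsClique H.verts := by
  obtain ⟨W', hW', ⟨e⟩⟩ := h
  have hcard : Nat.card H.verts ≤ 2 :=
    (Nat.card_congr e.toEquiv).trans_le ((Finite.card_subtype_le _).trans hU)
  have : Finite H.verts := Finite.of_equiv _ e.symm.toEquiv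
  have htop := eq_top_of_preconnected_of_card_le_two
    (e.connected_iff.2 hW'.coe).preconnected hcard
  intro x hx y hy hxy
  have hadj : H.coe.Adj ⟨x, hx⟩ ⟨y, hy⟩ := htop ▸ Subtype.coe_ne_coe.1 hxy
  exact H.adj_sub hadj

lemma isStructure_subgraphOfAdj (hW : W.Preconnected) (hU : Nat.card U = 2) {x y : V}
    (h : G.Adj x y) : IsStructure W (G.subgraphOfAdj h) := by
  have : Finite U := Nat.finite_of_card_ne_zero (by omega)
  have hcard : Nat.card (G.subgraphOfAdj h).verts = 2 := Set.ncard_pair h.ne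
  have : Finite (G.subgraphOfAdj h).verts := Nat.finite_of_card_ne_zero (by omega)
  rw [IsStructure, eq_top_of_preconnected_of_card_le_two hW hU.le,
    eq_top_of_preconnected_of_card_le_two
      (Subgraph.subgraphOfAdj_connected h).coe.preconnected hcard.le]
  exact (Finite.card_eq.1 (hcard.trans hU.symm)).map Iso.completeGraph

lemma isSubstructure_of_isStructure (hW : W.Connected) (h : IsStructure W H) :
    IsSubstructure W H :=
  let ⟨e⟩ := h
  ⟨⊤, ⟨Subgraph.topIso.connected_iff.2 hW⟩, ⟨e.trans Subgraph.topIso.symm⟩⟩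

end Structures

namespace hypercube

lemma one_connected : (hypercube 1).Connected := by
  convert connected_top (V := Fin 1 → Bool)
  ext x y
  exact ⟨Adj.ne, fun h => (hammingDist_le x y).antisymm (hammingDist_pos.2 h)⟩

lemma card_vertices_one : Nat.card (Fin 1 → Bool) = 2 := by simp

section EdgeFamily

variable {n : ℕ} {o l i j k : Fin n} {T : Finset (Fin n)} {x y : Fin n → Bool}

/-- The edge of the hypercube in direction `o` at the vertex `x`. -/
def bitEdge (x : Fin n → Bool) (o : Fin n) : (hypercube n).Subgraph :=
  (hypercube n).subgraphOfAdj (adj_flipBit x o)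

lemma mem_verts_bitEdge : y ∈ (bitEdge x o).verts ↔ ∀ j ≠ o, y j = x j := by
  change y = x ∨ y = flipBit x o ↔ _
  rw [eq_flipBit_iff, funext_iff]
  grind

/-- The edges in direction `o` at the strings whose only nonzero bit lies in `T`; the extremal
faults. -/
noncomputable def edgeFamily (o : Fin n) (T : Finset (Fin n)) :
    Finset (hypercube n).Subgraph :=
  open scoped Classical in T.image fun i => bitEdge (flipBit ⊥ i) o

lemma mem_edgeFamily {H : (hypercube n).Subgraph} :
    H ∈ edgeFamily o T ↔ ∃ i ∈ T, bitEdge (flipBit ⊥ i) o = H := by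
  simp [edgeFamily]

lemma eq_of_mem_bitEdge (hi : i ≠ o) (hxi : x ∈ (bitEdge (flipBit ⊥ i) o).verts)
    (hxj : x ∈ (bitEdge (flipBit ⊥ j) o).verts) : i = j := by
  by_contra hij
  have h := (mem_verts_bitEdge.1 hxi i hi).symm.trans (mem_verts_bitEdge.1 hxj i hi)
  simp [flipBit_of_ne hij] at h

lemma card_edgeFamily (hT : o ∉ T) : #(edgeFamily o T) = #T := by
  classical
  refine Finset.card_image_of_injOn fun i hi j _ hij => ?_
  have hmem : flipBit ⊥ i ∈ (bitEdge (flipBit ⊥ i) o).verts := Or.inl rfl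
  exact eq_of_mem_bitEdge (ne_of_mem_of_not_mem hi hT) hmem (hij ▸ hmem)

lemma isFaultFamily_edgeFamily {P : (hypercube n).Subgraph → Prop}
    (hP : ∀ H, IsStructure (hypercube 1) H → P H) (hT : o ∉ T) :
    IsFaultFamily P (edgeFamily o T) := by
  constructor
  · intro H hH
    obtain ⟨i, -, rfl⟩ := mem_edgeFamily.1 hH
    exact hP _ (isStructure_subgraphOfAdj one_connected.preconnected card_vertices_one _)
  · intro H hH K hK hne
    obtain ⟨i, hi, rfl⟩ := mem_edgeFamily.1 hH
    obtain ⟨j, -, rfl⟩ := mem_edgeFamily.1 hK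
    refine Set.disjoint_left.2 fun x hxi hxj => hne ?_
    rw [eq_of_mem_bitEdge (ne_of_mem_of_not_mem hi hT) hxi hxj]

lemma mem_survivors_edgeFamily :
    x ∈ survivors (edgeFamily o T) ↔ ∀ i ∈ T, x ∉ (bitEdge (flipBit ⊥ i) o).verts := by
  simp [survivors, mem_edgeFamily]

lemma bot_mem_survivors_edgeFamily (hT : o ∉ T) : ⊥ ∈ survivors (edgeFamily o T) :=
  mem_survivors_edgeFamily.2 fun i hi h => by
    simpa using mem_verts_bitEdge.1 h i (ne_of_mem_of_not_mem hi hT)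

lemma mem_survivors_edgeFamily_of_ne (hj : j ≠ o) (hk : k ≠ o) (hjk : j ≠ k)
    (hxj : x j = true) (hxk : x k = true) : x ∈ survivors (edgeFamily o T) := by
  refine mem_survivors_edgeFamily.2 fun i _ h => hjk ?_
  have heq : ∀ a ≠ o, x a = true → a = i := fun a ha hxa => by
    by_contra hai
    simpa [hxa, flipBit_of_ne hai] using mem_verts_bitEdge.1 h a ha
  rw [heq j hj hxj, heq k hk hxk]

lemma notMem_bitEdge_bot (hj : j ≠ o) (hxj : x j = true) : x ∉ (bitEdge ⊥ o).verts := fun h => by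
  simpa [hxj] using mem_verts_bitEdge.1 h j hj

lemma hammingDist_le_length {F : Finset (hypercube n).Subgraph} {u v : survivors F}
    (p : ((hypercube n).removeFamily F).Walk u v) : hammingDist u.1 v.1 ≤ p.length := by
  induction p with
  | nil => simp
  | @cons u w v h p ih =>
    have hadj : hammingDist u.1 w.1 = 1 := h
    have := hammingDist_triangle u.1 w.1 v.1
    rw [Walk.length_cons]
    omega

lemma exists_direction_of_adj (hx : x ∈ (bitEdge ⊥ o).verts) (hy : y ∉ (bitEdge ⊥ o).verts)
    (hyF : y ∈ survivors (edgeFamily o T)) (h : (hypercube n).Adj x y) :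
    ∃ l, l ≠ o ∧ l ∉ T ∧ y = flipBit x l := by
  obtain ⟨l, rfl⟩ := adj_iff_exists_eq_flipBit.1 h
  rw [mem_verts_bitEdge] at hx hy
  refine ⟨l, ?_, fun hl => mem_survivors_edgeFamily.1 hyF l hl (mem_verts_bitEdge.2 ?_), rfl⟩
  · rintro rfl
    exact hy fun j hj => (flipBit_of_ne hj).trans (hx j hj)
  · intro j hj
    by_cases hjl : j = l
    · subst hjl
      simp [hx j hj]
    · rw [flipBit_of_ne hjl, flipBit_of_ne hjl, hx j hj]

theorem exists_exit_direction {x y : survivors (edgeFamily o T)}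
    (p : ((hypercube n).removeFamily (edgeFamily o T)).Walk x y)
    (hx : x.1 ∈ (bitEdge ⊥ o).verts) (hy : y.1 ∉ (bitEdge ⊥ o).verts) :
    ∃ l, l ≠ o ∧ l ∉ T ∧ hammingDist (flipBit x.1 l) y.1 + 1 ≤ p.length := by
  induction p with
  | nil => exact absurd hx hy
  | @cons x z y h p ih =>
    rw [Walk.length_cons]
    by_cases hz : z.1 ∈ (bitEdge ⊥ o).verts
    · obtain ⟨l, hlo, hlT, hle⟩ := ih hz hy
      have hadj : hammingDist x.1 z.1 = 1 := h
      have := hammingDist_triangle (flipBit x.1 l) (flipBit z.1 l) y.1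
      rw [hammingDist_flipBit_flipBit] at this
      exact ⟨l, hlo, hlT, by omega⟩
    · obtain ⟨l, hlo, hlT, hzl⟩ := exists_direction_of_adj hx hz z.2 h
      exact ⟨l, hlo, hlT, hzl ▸ Nat.succ_le_succ (hammingDist_le_length p)⟩

theorem not_preconnected_removeFamily_edgeFamily (hn : 3 ≤ n) (o : Fin n) :
    ¬ ((hypercube n).removeFamily (edgeFamily o (Finset.univ.erase o))).Preconnected := by
  intro hconn
  obtain ⟨j, hj, k, hk, hjk⟩ := Finset.one_lt_card.1
    (by rw [Finset.card_erase_of_mem (Finset.mem_univ o), Finset.card_fin]; omega :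
      1 < #(Finset.univ.erase o))
  have hj := Finset.ne_of_mem_erase hj
  have hk := Finset.ne_of_mem_erase hk
  obtain ⟨p⟩ := hconn ⟨⊥, bot_mem_survivors_edgeFamily (Finset.notMem_erase o _)⟩
    ⟨⊤, mem_survivors_edgeFamily_of_ne hj hk hjk rfl rfl⟩
  obtain ⟨l, hlo, hl, -⟩ := exists_exit_direction p (Or.inl rfl) (notMem_bitEdge_bot hj rfl)
  exact hl (Finset.mem_erase.2 ⟨hlo, Finset.mem_univ l⟩)

lemma hammingDist_bot_top : hammingDist (⊥ : Fin n → Bool) ⊤ = n := by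
  simp [hammingDist]

theorem le_ediam_removeFamily_edgeFamily (hn : 4 ≤ n) (hlo : l ≠ o) :
    (n : ℕ∞) + 1 ≤
      ((hypercube n).removeFamily (edgeFamily o ((Finset.univ.erase o).erase l))).ediam := by
  have hmem : ∀ {i}, i ∈ (Finset.univ.erase o).erase l ↔ i ≠ l ∧ i ≠ o := by simp
  obtain ⟨j, hj, k, hk, hjk⟩ := Finset.one_lt_card.1
    (by rw [Finset.card_erase_of_mem (by simpa using hlo),
          Finset.card_erase_of_mem (Finset.mem_univ o), Finset.card_fin]; omega :
      1 < #((Finset.univ.erase o).erase l))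
  rw [hmem] at hj hk
  have htop : ∀ {i}, i ≠ l → flipBit (⊤ : Fin n → Bool) l i = true := flipBit_of_ne
  refine le_trans (le_iInf fun p => ?_) (edist_le_ediam
    (u := ⟨⊥, bot_mem_survivors_edgeFamily fun h => (hmem.1 h).2 rfl⟩)
    (v := ⟨flipBit ⊤ l, mem_survivors_edgeFamily_of_ne hj.2 hk.2 hjk (htop hj.1) (htop hk.1)⟩))
  obtain ⟨l', hlo', hl', hle⟩ := exists_exit_direction p (Or.inl rfl)
    (notMem_bitEdge_bot hj.2 (htop hj.1))
  obtain rfl : l' = l := by_contra fun h => hl' (hmem.2 ⟨h, hlo'⟩)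
  rw [hammingDist_flipBit_flipBit, hammingDist_bot_top] at hle
  exact_mod_cast hle

end EdgeFamily

lemma le_ediam_removeFamily_empty (n : ℕ) :
    (n : ℕ∞) ≤ ((hypercube n).removeFamily ∅).ediam := by
  refine le_trans (le_iInf fun p => ?_) (edist_le_ediam (u := ⟨⊥, by simp [survivors]⟩)
    (v := ⟨⊤, by simp [survivors]⟩))
  have := hammingDist_le_length p
  rw [hammingDist_bot_top] at this
  exact_mod_cast this

section FaultParameters

variable {n : ℕ} {P : (hypercube n).Subgraph → Prop} {F : Finset (hypercube n).Subgraph}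

lemma isClique_of_isFaultFamily (hP : ∀ H, P H → IsSubstructure (hypercube 1) H)
    (hF : IsFaultFamily P F) : ∀ H ∈ F, (hypercube n).IsClique H.verts :=
  fun H hH => isClique_of_isSubstructure card_vertices_one.le (hP H (hF.1 H hH))

variable (hP : ∀ H, IsStructure (hypercube 1) H → P H)
  (hP' : ∀ H, P H → IsSubstructure (hypercube 1) H)
include hP hP'

theorem faultConnectivity_eq (hn : 3 ≤ n) :
    (hypercube n).faultConnectivity P = ((n - 1 : ℕ) : ℕ∞) := by
  apply le_antisymm
  · have o : Fin n := ⟨0, by omega⟩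
    have hT : o ∉ Finset.univ.erase o := Finset.notMem_erase _ _
    refine sInf_le ⟨_, isFaultFamily_edgeFamily hP hT,
      not_preconnected_removeFamily_edgeFamily hn o, ?_⟩
    rw [card_edgeFamily hT, Finset.card_erase_of_mem (Finset.mem_univ _), Finset.card_fin]
  · refine le_sInf ?_
    rintro _ ⟨F, hF, hdis, rfl⟩
    by_contra! hlt
    have hcard : #F < n - 1 := by exact_mod_cast hlt
    have hle := ediam_removeFamily_le (isClique_of_isFaultFamily hP' hF) (by omega)
    exact hdis (preconnected_of_ediam_ne_top
      (ne_top_of_le_ne_top (ENat.natCast_ne_top (n + 1)) hle))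

lemma card_le_faultConnectivity_sub_one_iff (hn : 3 ≤ n) :
    (#F : ℕ∞) ≤ (hypercube n).faultConnectivity P - 1 ↔ #F ≤ n - 2 := by
  rw [faultConnectivity_eq hP hP' hn]
  norm_cast

theorem faultDiameter_eq (hn : 4 ≤ n) : (hypercube n).faultDiameter P = (n : ℕ∞) + 1 := by
  have hiff := fun F => card_le_faultConnectivity_sub_one_iff hP hP' (F := F) (by omega : 3 ≤ n)
  apply le_antisymm
  · refine sSup_le ?_
    rintro _ ⟨F, hF, hcard, rfl⟩
    exact ediam_removeFamily_le (isClique_of_isFaultFamily hP' hF) ((hiff F).1 hcard)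
  · let o : Fin n := ⟨0, by omega⟩
    let l : Fin n := ⟨1, by omega⟩
    have hlo : l ≠ o := by simp [l, o]
    have hT : o ∉ (Finset.univ.erase o).erase l := by simp
    refine (le_ediam_removeFamily_edgeFamily hn hlo).trans
      (le_sSup ⟨_, isFaultFamily_edgeFamily hP hT, (hiff _).2 ?_, rfl⟩)
    rw [card_edgeFamily hT, Finset.card_erase_of_mem (by simp [hlo]),
      Finset.card_erase_of_mem (Finset.mem_univ _), Finset.card_fin]
    omega

end FaultParameters

theorem faultDiameter_three_eq {P : (hypercube 3).Subgraph → Prop}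
    (hP : ∀ H, IsStructure (hypercube 1) H → P H)
    (hP' : ∀ H, P H → IsSubstructure (hypercube 1) H) : (hypercube 3).faultDiameter P = 3 := by
  apply le_antisymm
  · refine sSup_le ?_
    rintro _ ⟨F, hF, hcard, rfl⟩
    exact ediam_removeFamily_three_le (isClique_of_isFaultFamily hP' hF)
      ((card_le_faultConnectivity_sub_one_iff hP hP' le_rfl).1 hcard)
  · exact (le_ediam_removeFamily_empty 3).trans
      (le_sSup ⟨∅, ⟨by simp, by simp⟩, by simp, rfl⟩)

end hypercube

theorem theorem3p7 :
    (∀ n : ℕ, 3 ≤ n →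
      (hypercube n).structureConnectivity (hypercube 1) = ((n - 1 : ℕ) : ℕ∞) ∧
      (hypercube n).substructureConnectivity (hypercube 1) = ((n - 1 : ℕ) : ℕ∞)) ∧
    ((hypercube 3).substructureFaultDiameter (hypercube 1) = 3 ∧
      (hypercube 3).structureFaultDiameter (hypercube 1) = 3) ∧
    (∀ n : ℕ, 4 ≤ n →
      (hypercube n).substructureFaultDiameter (hypercube 1) = (n : ℕ∞) + 1 ∧
      (hypercube n).structureFaultDiameter (hypercube 1) = (n : ℕ∞) + 1) := by
  have hsub : ∀ {n : ℕ} (H : (hypercube n).Subgraph), IsStructure (hypercube 1) H →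
      IsSubstructure (hypercube 1) H := fun _ =>
    isSubstructure_of_isStructure hypercube.one_connected
  exact ⟨fun n hn => ⟨hypercube.faultConnectivity_eq (fun _ => id) hsub hn,
      hypercube.faultConnectivity_eq hsub (fun _ => id) hn⟩,
    ⟨hypercube.faultDiameter_three_eq hsub (fun _ => id),
      hypercube.faultDiameter_three_eq (fun _ => id) hsub⟩,
    fun n hn => ⟨hypercube.faultDiameter_eq hsub (fun _ => id) hn,
      hypercube.faultDiameter_eq (fun _ => id) hsub hn⟩⟩
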